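/- A weighted graph is a finite simple graph together with a positive integer weight on each vertex; a clique is a graph in which every two distinct vertices are adjacent. $\overline{G}$ denotes the complement of $G$ with the same weights, and $G\odot H$ denotes the join (the disjoint union of $G$ and $H$ together with all edges between a vertex of $G$ and a vertex of $H$). The Kromatic symmetric function of $G$ is $$\overline{X}_G=\sum_\kappa\prod_{v\in V(G)}\prod_{i\in\kappa(v)}x_i^{w(v)},$$ where $\kappa$ runs over all assignments of a nonempty finite set $\kappa(v)$ of positive integers to each vertex $v$ such that adjacent vertices get disjoint sets. Let $\mathbb{K}$ be a field of characteristic $0$, and let $\overline{\widetilde{\Lambda}}$ be the completion of Tsujie's ring of symmetric functions. As a vector space, it is the space of all symmetric power series over $\mathbb{K}$, possibly of unbounded degree, in $x_1,x_2,\dots$. A family of elements of $\overline{\widetilde{\Lambda}}$ is a pseudobasis if every element of $\overline{\widetilde{\Lambda}}$ can be written in exactly one way as a possibly infinite linear combination of the family (one in which each monomial has a nonzero coefficient in only finitely many of the summands). Let $G_1,G_2,\dots$ be a sequence of weighted graphs. For a partition $\lambda=(\lambda_1,\dots,\lambda_\ell)$ (possibly empty) put $\overline{X}_{\overline{G_\lambda}}:=\overline{X}_{\overline{G_{\lambda_1}}\odot\cdots\odot\overline{G_{\lambda_\ell}}}$.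 Then the family $(\overline{X}_{\overline{G_\lambda}})_\lambda$, indexed by all partitions $\lambda$, is a pseudobasis of $\overline{\widetilde{\Lambda}}$ if and only if, up to reordering the sequence, $G_n$ is a clique of total weight $n$ for every $n\ge 1$; that is, if and only if there is a permutation $\sigma$ of the positive integers such that $G_{\sigma(n)}$ is a clique of total weight $n$ for every $n\ge 1$. -/

import Mathlib

universe u

/-- A weighted graph: a finite simple graph whose vertices carry positive integer weights. -/
structure WGraph where
  V : Type u
  [fintypeV : Fintype V]
  graph : SimpleGraph V
  weight : V → ℕ+

namespace WGraph

attribute [instance] WGraph.fintypeV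

/-- The graph without vertices. -/
def empty : WGraph.{u} where
  V := PEmpty.{u + 1}
  graph := ⊥
  weight := fun v => v.elim

/-- The complement, with the same weighted vertices. -/
def compl (G : WGraph.{u}) : WGraph.{u} where
  V := G.V
  graph := G.graphᶜ
  weight := G.weight

/-- The join `G ⊙ H`: the disjoint union of `G` and `H` together with all edges between a vertex
of `G` and a vertex of `H`. -/
def join (G H : WGraph.{u}) : WGraph.{u} where
  V := G.V ⊕ H.V
  graph := SimpleGraph.sum G.graph H.graph ⊔ completeBipartiteGraph G.V H.V
  weight := Sum.elim G.weight H.weight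

/-- The join of a list of weighted graphs; the join of the empty list is the empty graph. -/
def joinList : List WGraph.{u} → WGraph.{u}
  | [] => empty
  | G :: l => join G (joinList l)

/-- The total weight of all vertices. -/
def totalWeight (G : WGraph.{u}) : ℕ := ∑ v, (G.weight v : ℕ)

/-- There is an edge between every two distinct vertices. -/
def IsClique (G : WGraph.{u}) : Prop := ∀ v w : G.V, v ≠ w → G.graph.Adj v w

/-- A proper set coloring gives every vertex a nonempty finite set of colors, such that adjacent
vertices get disjoint sets. The colors, like the variables below, are indexed by `ℕ`. -/
def IsProperSetColoring (G : WGraph.{u}) (κ : G.V → Finset ℕ) : Prop :=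
  (∀ v, (κ v).Nonempty) ∧ ∀ v w, G.graph.Adj v w → Disjoint (κ v) (κ w)

/-- The exponent vector of the monomial `∏ v, ∏ i ∈ κ v, x_i ^ weight v`. -/
noncomputable def colorExponent (G : WGraph.{u}) (κ : G.V → Finset ℕ) : ℕ →₀ ℕ :=
  ∑ v, ∑ i ∈ κ v, Finsupp.single i (G.weight v : ℕ)

/-- The proper set colorings whose monomial is `x ^ d`. -/
def colorings (G : WGraph.{u}) (d : ℕ →₀ ℕ) : Set (G.V → Finset ℕ) :=
  {κ | G.IsProperSetColoring κ ∧ G.colorExponent κ = d}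

/-- Each monomial comes from finitely many proper set colorings only, so the Kromatic symmetric
function is a well-defined power series and its coefficients below are true cardinalities. -/
theorem colorings_finite (G : WGraph.{u}) (d : ℕ →₀ ℕ) : (G.colorings d).Finite := by
  classical
  refine (Set.Finite.pi' (t := fun _ : G.V => {s : Finset ℕ | s ⊆ d.support}) fun _ => ?_).subset ?_
  · exact (Finset.finite_toSet d.support.powerset).subset fun s hs => by simpa using hs
  · rintro κ ⟨-, rfl⟩ v i hi
    have h1 : Finsupp.single i (G.weight v : ℕ) ≤ G.colorExponent κ :=
      (Finset.single_le_sum (f := fun i => Finsupp.single i (G.weight v : ℕ))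
        (fun _ _ => zero_le) hi).trans
        (Finset.single_le_sum (f := fun v => ∑ i ∈ κ v, Finsupp.single i (G.weight v : ℕ))
        (fun _ _ => zero_le) (Finset.mem_univ v))
    have h2 := h1 i
    have h3 := (G.weight v).pos
    simp only [Finsupp.single_eq_same] at h2
    simp only [Finsupp.mem_support_iff]
    omega

/-- The Kromatic symmetric function: the sum of the monomials of all proper set colorings,
as a power series in the variables `x_i`, `i ∈ ℕ`. -/
noncomputable def ksf (K : Type*) [Semiring K] (G : WGraph.{u}) : MvPowerSeries ℕ K :=
  fun d => ((G.colorings d).ncard : K)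

/-- For a sequence `G₁, G₂, …` and a partition `p` (a multiset of positive integers), the join of
the complements of the `G_i` over all parts `i` of `p`. -/
def coJoin (G : ℕ+ → WGraph.{u}) (p : Multiset ℕ+) : WGraph.{u} :=
  joinList ((p.sort (· ≥ ·)).map fun i => (G i).compl)

end WGraph

/-- The completion of the space of symmetric functions: all symmetric power series over `K` in
countably many variables, of possibly unbounded degree. Tsujie's modified ring of symmetric
functions differs from the usual one in its multiplication only, so this is also the vector space
underlying its completion. -/
def symmetricSeries (K : Type*) [Semiring K] : Submodule K (MvPowerSeries ℕ K) where
  carrier := {f | ∀ (σ : Equiv.Perm ℕ) (d : ℕ →₀ ℕ),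
    MvPowerSeries.coeff (d.mapDomain σ) f = MvPowerSeries.coeff d f}
  zero_mem' := by intro σ d; simp
  add_mem' := by intro f g hf hg σ d; simp [hf σ d, hg σ d]
  smul_mem' := by intro a f hf σ d; simp [hf σ d]

/-- `f` is the possibly infinite linear combination `∑ i, c i • b i`: each monomial has a nonzero
coefficient in finitely many summands only, and these coefficients add up to that of `f`. -/
def IsLinComb {K ι : Type*} [Semiring K] (b : ι → MvPowerSeries ℕ K) (c : ι → K)
    (f : MvPowerSeries ℕ K) : Prop :=
  ∀ d : ℕ →₀ ℕ, {i | c i * MvPowerSeries.coeff d (b i) ≠ 0}.Finite ∧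
    MvPowerSeries.coeff d f = ∑ᶠ i, c i * MvPowerSeries.coeff d (b i)

/-- A family in a space `W` of power series is a pseudobasis if each element of `W` is a possibly
infinite linear combination of the family in exactly one way. -/
def IsPseudobasis {K ι : Type*} [Semiring K] (W : Submodule K (MvPowerSeries ℕ K))
    (b : ι → MvPowerSeries ℕ K) : Prop :=
  (∀ i, b i ∈ W) ∧ ∀ f ∈ W, ∃! c : ι → K, IsLinComb b c f

/-! If every `G n` is a clique of weight `n`, its complement is edgeless, so a single color on it
gives `x_i ^ n`. Factors of a join use disjoint sets of colors. Hence a monomial of the series of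
`p` has at least `p.card` variables, and with exactly `p.card` every factor is monochromatic and the
exponents are the parts of `p` (`joinList_coloring_support`). A symmetric series is determined by
one coefficient per partition, so an expansion is a system of equations that is triangular in the
number of parts, with nonzero diagonal; `existsUnique_of_triangular` solves it.

Conversely, expand the series of one vertex of weight `k`. It contains `x₀ ^ k`, hence so does some
member of the family. One color suffices only for an edgeless join, which has a single nonempty
factor, so some `G n` is a clique of weight `k`. Choosing such an `n = s k` for each `k` gives an
injection `s`, and by the first direction the partitions with parts in the range of `s` already give
a pseudobasis. An index `m` outside the range would give the series of `{m}` a second expansion. -/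

namespace Finsupp

/-! ### Monomials up to permutation of the variables -/

/-- The multiset of the nonzero values of a finitely supported function. -/
def values {α : Type*} (d : α →₀ ℕ) : Multiset ℕ := d.support.val.map d

theorem card_values {α : Type*} (d : α →₀ ℕ) : d.values.card = d.support.card := by
  simp [values]

theorem values_single {α : Type*} (i : α) {n : ℕ} (hn : n ≠ 0) : (single i n).values = {n} := by
  simp [values, support_single, hn]

theorem values_add {α : Type*} {d e : α →₀ ℕ} (h : Disjoint d.support e.support) :
    (d + e).values = d.values + e.values := by
  classical
  rw [values, support_add_eq h, ← Finset.disjUnion_eq_union _ _ h, Finset.disjUnion_val,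
    Multiset.map_add]
  congr 1
  · refine Multiset.map_congr rfl fun x hx => ?_
    have : e x = 0 := notMem_support_iff.1 (Finset.disjoint_left.1 h hx)
    simp [this]
  · refine Multiset.map_congr rfl fun x hx => ?_
    have : d x = 0 := notMem_support_iff.1 (Finset.disjoint_right.1 h hx)
    simp [this]

theorem count_values {α : Type*} (d : α →₀ ℕ) {v : ℕ} (hv : v ≠ 0) :
    d.values.count v = Nat.card {x // d x = v} := by
  classical
  rw [values, Multiset.count_map, ← Finset.filter_val, ← Finset.card_def,
    ← Nat.card_eq_finsetCard]
  refine Nat.card_congr (Equiv.subtypeEquivRight fun x => ?_)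
  simp only [Finset.mem_filter, mem_support_iff]
  constructor
  · rintro ⟨-, h⟩
    exact h.symm
  · rintro rfl
    exact ⟨hv, rfl⟩

theorem finite_fiber {α : Type*} (d : α →₀ ℕ) {v : ℕ} (hv : v ≠ 0) : Finite {x // d x = v} :=
  (d.support.finite_toSet.subset fun x (hx : d x = v) => by simp [hx, hv]).to_subtype

theorem infinite_zero_fiber {α : Type*} [Infinite α] (d : α →₀ ℕ) : Infinite {x // d x = 0} := by
  have h := d.support.finite_toSet.infinite_compl.to_subtype
  exact (Equiv.subtypeEquivRight fun x => by simp : _ ≃ {x // d x = 0}).infinite_iff.1 h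

/-- Two exponent vectors with the same nonzero values differ by a permutation. -/
theorem exists_mapDomain_eq_of_values_eq {d e : ℕ →₀ ℕ} (h : d.values = e.values) :
    ∃ σ : Equiv.Perm ℕ, d.mapDomain σ = e := by
  have key : ∀ v, Nonempty ({x // d x = v} ≃ {x // e x = v}) := by
    intro v
    rcases eq_or_ne v 0 with rfl | hv
    -- The supports are finite, so both fibers over `0` are countably infinite; the other fibers are
    -- finite and counted by `values`.
    · have := d.infinite_zero_fiber
      have := e.infinite_zero_fiber
      exact nonempty_equiv_of_countable
    · have := d.finite_fiber hv
      have := e.finite_fiber hv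
      exact Finite.card_eq.1 (by rw [← count_values d hv, ← count_values e hv, h])
  let E := fun v => (key v).some
  let σ : Equiv.Perm ℕ := (Equiv.sigmaFiberEquiv d).symm.trans
    ((Equiv.sigmaCongrRight fun v => E v).trans (Equiv.sigmaFiberEquiv e))
  have hσ : ∀ x, e (σ x) = d x := fun x => (E (d x) ⟨x, rfl⟩).2
  refine ⟨σ, Finsupp.ext fun y => ?_⟩
  rw [mapDomain_equiv_apply, ← hσ, Equiv.apply_symm_apply]

theorem exists_pnat_values {α : Type*} (d : α →₀ ℕ) :
    ∃ p : Multiset ℕ+, p.map (fun i : ℕ+ => (i : ℕ)) = d.values := by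
  have h : ∀ n ∈ d.values, 0 < n := by
    intro n hn
    obtain ⟨x, hx, rfl⟩ := Multiset.mem_map.1 hn
    exact Nat.pos_of_ne_zero (mem_support_iff.1 hx)
  refine ⟨d.values.map Nat.toPNat', ?_⟩
  rw [Multiset.map_map]
  refine (Multiset.map_congr rfl fun n hn => ?_).trans (Multiset.map_id _)
  simp [h n hn]

end Finsupp

theorem coeff_eq_of_values_eq {K : Type*} [Semiring K] {f : MvPowerSeries ℕ K}
    (hf : f ∈ symmetricSeries K) {d e : ℕ →₀ ℕ} (h : d.values = e.values) :
    MvPowerSeries.coeff d f = MvPowerSeries.coeff e f := by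
  obtain ⟨σ, rfl⟩ := Finsupp.exists_mapDomain_eq_of_values_eq h
  exact (hf σ d).symm

/-! ### Symmetry and isomorphism invariance -/

namespace WGraph

theorem coeff_ksf {K : Type*} [Semiring K] (G : WGraph.{u}) (d : ℕ →₀ ℕ) :
    MvPowerSeries.coeff d (G.ksf K) = ((G.colorings d).ncard : K) := rfl

theorem coeff_ksf_ne_zero_iff {K : Type*} [Semiring K] [CharZero K] (G : WGraph.{u})
    (d : ℕ →₀ ℕ) :
    MvPowerSeries.coeff d (G.ksf K) ≠ 0 ↔ ∃ κ, G.IsProperSetColoring κ ∧ G.colorExponent κ = d := by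
  rw [coeff_ksf, Nat.cast_ne_zero, ← Nat.pos_iff_ne_zero, Set.ncard_pos (G.colorings_finite d)]
  rfl

/-- Renaming the colors by `σ` is a bijection between the colorings for `d` and those for its image.
-/
theorem ksf_mem_symmetricSeries (K : Type*) [Semiring K] (G : WGraph.{u}) :
    G.ksf K ∈ symmetricSeries K := by
  intro σ d
  rw [coeff_ksf, coeff_ksf]
  congr 1
  refine (Nat.card_congr (Equiv.subtypeEquiv (Equiv.piCongrRight fun _ => σ.finsetCongr)
    fun κ => ?_)).symm
  have h : G.colorExponent (Equiv.piCongrRight (fun _ => σ.finsetCongr) κ) =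
      (G.colorExponent κ).mapDomain σ := by
    simp [colorExponent, Finsupp.mapDomain_finsetSum, Finsupp.mapDomain_single]
  change (G.IsProperSetColoring _ ∧ _) ↔ (G.IsProperSetColoring _ ∧ _)
  rw [h, (Finsupp.mapDomain_injective σ.injective).eq_iff]
  simp [IsProperSetColoring, Finset.disjoint_map]

theorem join_adj_inl_inl {G H : WGraph.{u}} {v w : G.V} :
    (G.join H).graph.Adj (Sum.inl v) (Sum.inl w) ↔ G.graph.Adj v w := by
  simp [join]

theorem join_adj_inr_inr {G H : WGraph.{u}} {v w : H.V} :
    (G.join H).graph.Adj (Sum.inr v) (Sum.inr w) ↔ H.graph.Adj v w := by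
  simp [join]

theorem join_adj_inl_inr {G H : WGraph.{u}} (v : G.V) (w : H.V) :
    (G.join H).graph.Adj (Sum.inl v) (Sum.inr w) := by
  simp [join]

theorem join_adj_inr_inl {G H : WGraph.{u}} (v : H.V) (w : G.V) :
    (G.join H).graph.Adj (Sum.inr v) (Sum.inl w) := by
  simp [join]

/-- Isomorphism of weighted graphs. -/
def Isomorphic (G H : WGraph.{u}) : Prop :=
  ∃ e : G.V ≃ H.V, (∀ v w, H.graph.Adj (e v) (e w) ↔ G.graph.Adj v w) ∧
    ∀ v, H.weight (e v) = G.weight v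

theorem Isomorphic.ksf_eq {G H : WGraph.{u}} (h : G.Isomorphic H) (K : Type*) [Semiring K] :
    G.ksf K = H.ksf K := by
  obtain ⟨e, hadj, hw⟩ := h
  ext d
  rw [coeff_ksf, coeff_ksf]
  congr 1
  refine (Nat.card_congr (Equiv.subtypeEquiv (Equiv.arrowCongr e.symm (Equiv.refl _))
    fun κ => ?_)).symm
  have h : G.colorExponent (Equiv.arrowCongr e.symm (Equiv.refl _) κ) = H.colorExponent κ := by
    refine Fintype.sum_equiv e _ _ fun v => ?_
    simp [hw]
  change (H.IsProperSetColoring _ ∧ _) ↔ (G.IsProperSetColoring _ ∧ _)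
  rw [h]
  simp [IsProperSetColoring, ← hadj, e.forall_congr_left]

theorem Isomorphic.trans {G H J : WGraph.{u}} (h₁ : G.Isomorphic H) (h₂ : H.Isomorphic J) :
    G.Isomorphic J := by
  obtain ⟨e, he, he'⟩ := h₁
  obtain ⟨f, hf, hf'⟩ := h₂
  exact ⟨e.trans f, by simp [he, hf], by simp [he', hf']⟩

theorem Isomorphic.refl (G : WGraph.{u}) : G.Isomorphic G := ⟨Equiv.refl _, by simp, by simp⟩

theorem Isomorphic.join_right {H J : WGraph.{u}} (h : H.Isomorphic J) (G : WGraph.{u}) :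
    (G.join H).Isomorphic (G.join J) := by
  obtain ⟨e, he, he'⟩ := h
  refine ⟨Equiv.sumCongr (Equiv.refl _) e, ?_, ?_⟩
  · rintro (v | v) (w | w)
    · exact join_adj_inl_inl.trans join_adj_inl_inl.symm
    · exact iff_of_true (join_adj_inl_inr _ _) (join_adj_inl_inr _ _)
    · exact iff_of_true (join_adj_inr_inl _ _) (join_adj_inr_inl _ _)
    · exact join_adj_inr_inr.trans ((he v w).trans join_adj_inr_inr.symm)
  · rintro (v | v)
    exacts [rfl, he' v]

theorem isomorphic_join_left_comm (G H J : WGraph.{u}) :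
    (G.join (H.join J)).Isomorphic (H.join (G.join J)) := by
  refine ⟨(Equiv.sumAssoc _ _ _).symm.trans
    ((Equiv.sumCongr (Equiv.sumComm _ _) (Equiv.refl _)).trans (Equiv.sumAssoc _ _ _)), ?_, ?_⟩
  · rintro (v | v | v) (w | w | w)
    · exact join_adj_inr_inr.trans (join_adj_inl_inl.trans join_adj_inl_inl.symm)
    · exact iff_of_true (join_adj_inr_inl _ _) (join_adj_inl_inr _ _)
    · exact iff_of_true (join_adj_inr_inr.2 (join_adj_inl_inr _ _)) (join_adj_inl_inr _ _)
    · exact iff_of_true (join_adj_inl_inr _ _) (join_adj_inr_inl _ _)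
    · exact join_adj_inl_inl.trans (join_adj_inl_inl.symm.trans join_adj_inr_inr.symm)
    · exact iff_of_true (join_adj_inl_inr _ _) (join_adj_inr_inr.2 (join_adj_inl_inr _ _))
    · exact iff_of_true (join_adj_inr_inr.2 (join_adj_inr_inl _ _)) (join_adj_inr_inl _ _)
    · exact iff_of_true (join_adj_inr_inl _ _) (join_adj_inr_inr.2 (join_adj_inr_inl _ _))
    · exact join_adj_inr_inr.trans (join_adj_inr_inr.trans
        (join_adj_inr_inr.symm.trans join_adj_inr_inr.symm))
  · rintro (v | v | v) <;> rfl

theorem isomorphic_joinList_of_perm {l l' : List WGraph.{u}} (h : l.Perm l') :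
    (joinList l).Isomorphic (joinList l') := by
  induction h with
  | nil => exact .refl _
  | cons G _ ih => exact ih.join_right G
  | swap G H l => exact isomorphic_join_left_comm _ _ _
  | trans _ _ ih₁ ih₂ => exact ih₁.trans ih₂

/-- Relabeling by `s` need not respect the sorting in `coJoin`, so the two lists of factors agree
only up to permutation. -/
theorem ksf_coJoin_comp (K : Type*) [Semiring K] (G : ℕ+ → WGraph.{u}) (s : ℕ+ → ℕ+)
    (p : Multiset ℕ+) :
    (coJoin (fun n => G (s n)) p).ksf K = (coJoin G (p.map s)).ksf K := by
  refine Isomorphic.ksf_eq (isomorphic_joinList_of_perm ?_) K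
  rw [← Multiset.coe_eq_coe, ← Multiset.map_coe, ← Multiset.map_coe, Multiset.sort_eq,
    Multiset.sort_eq, Multiset.map_map]
  rfl

theorem totalWeight_compl (G : WGraph.{u}) : G.compl.totalWeight = G.totalWeight := rfl

theorem IsClique.compl_eq_bot {G : WGraph.{u}} (h : G.IsClique) : G.compl.graph = ⊥ := by
  ext v w
  exact iff_of_false (fun hvw => hvw.2 (h v w hvw.1)) id

theorem isClique_of_compl_eq_bot {G : WGraph.{u}} (h : G.compl.graph = ⊥) : G.IsClique := by
  intro v w hvw
  by_contra hadj
  have : G.compl.graph.Adj v w := ⟨hvw, hadj⟩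
  rw [h] at this
  exact this

theorem nonempty_of_totalWeight_pos {G : WGraph.{u}} (h : 0 < G.totalWeight) : Nonempty G.V := by
  obtain ⟨v, -, -⟩ := Finset.exists_ne_zero_of_sum_ne_zero h.ne'
  exact ⟨v⟩

/-! ### Colors used by joins -/

theorem support_colorExponent (G : WGraph.{u}) (κ : G.V → Finset ℕ) (i : ℕ) :
    i ∈ (G.colorExponent κ).support ↔ ∃ v, i ∈ κ v := by
  classical
  have h : ∀ v, (∑ j ∈ κ v, Finsupp.single j (G.weight v : ℕ)) i =
      if i ∈ κ v then (G.weight v : ℕ) else 0 := by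
    intro v
    simp [Finsupp.finsetSum_apply, Finsupp.single_apply]
  simp [colorExponent, Finsupp.finsetSum_apply, h]

theorem colorExponent_const (G : WGraph.{u}) (i : ℕ) :
    G.colorExponent (fun _ => {i}) = Finsupp.single i G.totalWeight := by
  simp [colorExponent, totalWeight, Finsupp.single_finsetSum]

theorem totalWeight_le_degree {G : WGraph.{u}} {κ : G.V → Finset ℕ}
    (hκ : G.IsProperSetColoring κ) : G.totalWeight ≤ (G.colorExponent κ).degree := by
  rw [colorExponent, map_sum]
  refine Finset.sum_le_sum fun v _ => ?_
  rw [map_sum]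
  simp only [Finsupp.degree_single, Finset.sum_const, smul_eq_mul]
  exact Nat.le_mul_of_pos_left _ (hκ.1 v).card_pos

theorem colorExponent_join (G H : WGraph.{u}) (κ : (G.join H).V → Finset ℕ) :
    (G.join H).colorExponent κ =
      G.colorExponent (fun v => κ (Sum.inl v)) + H.colorExponent (fun v => κ (Sum.inr v)) :=
  Fintype.sum_sum_type _

theorem totalWeight_join (G H : WGraph.{u}) :
    (G.join H).totalWeight = G.totalWeight + H.totalWeight :=
  Fintype.sum_sum_type _

/-- Disjointness is put in terms of supports so that `Finsupp.values_add` applies. -/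
theorem isProperSetColoring_join {G H : WGraph.{u}} {κ : (G.join H).V → Finset ℕ} :
    (G.join H).IsProperSetColoring κ ↔
      G.IsProperSetColoring (fun v => κ (Sum.inl v)) ∧
      H.IsProperSetColoring (fun v => κ (Sum.inr v)) ∧
      Disjoint (G.colorExponent fun v => κ (Sum.inl v)).support
        (H.colorExponent fun v => κ (Sum.inr v)).support := by
  have hd : Disjoint (G.colorExponent fun v => κ (Sum.inl v)).support
      (H.colorExponent fun v => κ (Sum.inr v)).support ↔
      ∀ v w, Disjoint (κ (Sum.inl v)) (κ (Sum.inr w)) := by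
    simp only [Finset.disjoint_left, support_colorExponent]
    exact ⟨fun h v w i hv hw => h ⟨v, hv⟩ ⟨w, hw⟩, fun h i ⟨v, hv⟩ ⟨w, hw⟩ => h v w hv hw⟩
  rw [hd]
  constructor
  · rintro ⟨h₁, h₂⟩
    exact ⟨⟨fun v => h₁ _, fun v w h => h₂ _ _ (join_adj_inl_inl.2 h)⟩,
      ⟨fun v => h₁ _, fun v w h => h₂ _ _ (join_adj_inr_inr.2 h)⟩,
      fun v w => h₂ _ _ (join_adj_inl_inr v w)⟩
  · rintro ⟨⟨h₁, h₂⟩, ⟨h₃, h₄⟩, h₅⟩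
    refine ⟨?_, ?_⟩
    · rintro (v | v)
      exacts [h₁ v, h₃ v]
    · rintro (v | v) (w | w) h
      · exact h₂ _ _ (join_adj_inl_inl.1 h)
      · exact h₅ _ _
      · exact (h₅ _ _).symm
      · exact h₄ _ _ (join_adj_inr_inr.1 h)

theorem totalWeight_joinList (l : List WGraph.{u}) :
    (joinList l).totalWeight = (l.map totalWeight).sum := by
  induction l with
  | nil => exact Finset.sum_empty
  | cons G l ih => rw [joinList, totalWeight_join, ih, List.map_cons, List.sum_cons]

/-- A coloring of a nonempty graph with only one color is constant. -/
theorem colorExponent_eq_single {G : WGraph.{u}} {κ : G.V → Finset ℕ}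
    (hκ : G.IsProperSetColoring κ) (h : (G.colorExponent κ).support.card = 1) :
    ∃ i, G.colorExponent κ = Finsupp.single i G.totalWeight := by
  obtain ⟨i, hi⟩ := Finset.card_eq_one.1 h
  refine ⟨i, ?_⟩
  have : κ = fun _ => {i} := by
    funext v
    refine (hκ.1 v).subset_singleton_iff.1 fun j hj => ?_
    rw [← hi, support_colorExponent]
    exact ⟨v, hj⟩
  rw [this, colorExponent_const]

theorem card_support_pos {G : WGraph.{u}} (hG : 0 < G.totalWeight) {κ : G.V → Finset ℕ}
    (hκ : G.IsProperSetColoring κ) : 0 < (G.colorExponent κ).support.card := by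
  obtain ⟨v⟩ := nonempty_of_totalWeight_pos hG
  obtain ⟨i, hi⟩ := hκ.1 v
  exact Finset.card_pos.2 ⟨i, (support_colorExponent _ _ _).2 ⟨v, hi⟩⟩

/-- A coloring of the join of nonempty graphs uses at least as many colors as there are graphs, and
in case of equality its exponents are the total weights of the graphs. -/
theorem joinList_coloring_support (l : List WGraph.{u}) (hl : ∀ G ∈ l, 0 < G.totalWeight)
    (κ : (joinList l).V → Finset ℕ) (hκ : (joinList l).IsProperSetColoring κ) :
    l.length ≤ ((joinList l).colorExponent κ).support.card ∧
      (((joinList l).colorExponent κ).support.card = l.length →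
        ((joinList l).colorExponent κ).values = (l.map totalWeight : List ℕ)) := by
  induction l with
  | nil =>
    refine ⟨Nat.zero_le _, fun h => ?_⟩
    rw [← Finsupp.card_values] at h
    simpa using h
  | cons G l ih =>
    obtain ⟨h₁, h₂, hd⟩ := isProperSetColoring_join.1 hκ
    obtain ⟨h₃, h₄⟩ := ih (fun G hG => hl G (List.mem_cons_of_mem _ hG)) _ h₂
    have h₅ := card_support_pos (hl G List.mem_cons_self) h₁
    have hc := colorExponent_join G (joinList l) κ
    have hv := Finsupp.values_add hd
    have hcard := congrArg Multiset.card hv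
    rw [Multiset.card_add, Finsupp.card_values, Finsupp.card_values, Finsupp.card_values] at hcard
    change _ ≤ ((G.join (joinList l)).colorExponent κ).support.card ∧
      (((G.join (joinList l)).colorExponent κ).support.card = _ →
        ((G.join (joinList l)).colorExponent κ).values = _)
    rw [hc, hcard, hv, List.length_cons]
    refine ⟨by omega, fun h => ?_⟩
    -- Equality forces both lower bounds to be attained: one color on `G` and `l.length` on the
    -- rest.
    obtain ⟨i, hi⟩ := colorExponent_eq_single h₁ (by omega)
    rw [h₄ (by omega), hi, Finsupp.values_single _ (hl G List.mem_cons_self).ne']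
    rfl

theorem exists_joinList_coloring (l : List WGraph.{u}) (hl : ∀ G ∈ l, 0 < G.totalWeight)
    (hbot : ∀ G ∈ l, G.graph = ⊥) :
    ∃ κ, (joinList l).IsProperSetColoring κ ∧
      ((joinList l).colorExponent κ).values = (l.map totalWeight : List ℕ) := by
  induction l with
  | nil =>
    refine ⟨fun _ => ∅, ⟨fun v => v.elim, fun v => v.elim⟩, ?_⟩
    have : (joinList []).colorExponent (fun _ => ∅) = 0 := Finset.sum_empty
    rw [this]
    rfl
  | cons G l ih =>
    obtain ⟨κ, h₁, h₂⟩ := ih (fun G hG => hl G (List.mem_cons_of_mem _ hG))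
      (fun G hG => hbot G (List.mem_cons_of_mem _ hG))
    -- A fresh color for the whole edgeless factor `G`.
    obtain ⟨i, hi⟩ := Infinite.exists_notMem_finset ((joinList l).colorExponent κ).support
    have hd : Disjoint (G.colorExponent fun _ => {i}).support
        ((joinList l).colorExponent κ).support := by
      rw [colorExponent_const]
      exact (Finset.disjoint_singleton_left.2 hi).mono_left Finsupp.support_single_subset
    refine ⟨Sum.elim (fun _ => {i}) κ, isProperSetColoring_join.2 ⟨⟨by simp, ?_⟩, h₁, hd⟩, ?_⟩
    · simp [hbot G List.mem_cons_self]
    · refine (congrArg Finsupp.values (colorExponent_join G (joinList l) _)).trans ?_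
      refine (Finsupp.values_add hd).trans ?_
      rw [h₂, colorExponent_const, Finsupp.values_single _ (hl G List.mem_cons_self).ne']
      rfl

/-- If a join of graphs has no edges and is not empty, then it has only one nonempty factor. -/
theorem exists_mem_of_joinList_eq_bot (l : List WGraph.{u}) (hbot : (joinList l).graph = ⊥)
    (hl : 0 < (joinList l).totalWeight) :
    ∃ G ∈ l, G.graph = ⊥ ∧ G.totalWeight = (joinList l).totalWeight := by
  induction l with
  | nil => exact absurd hl (by simp [totalWeight_joinList])
  | cons G l ih =>
    have hadj : ∀ v w, ¬ (joinList (G :: l)).graph.Adj v w := by simp [hbot]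
    have hw := totalWeight_join G (joinList l)
    change (joinList (G :: l)).totalWeight = _ at hw
    rcases Nat.eq_zero_or_pos (joinList l).totalWeight with h0 | h0
    · refine ⟨G, List.mem_cons_self, ?_, by omega⟩
      ext v w
      simpa [joinList, join] using hadj (Sum.inl v) (Sum.inl w)
    -- Two nonempty sides of a join would be linked by an edge.
    · have hG : G.totalWeight = 0 := by
        by_contra hG
        obtain ⟨v⟩ := nonempty_of_totalWeight_pos (Nat.pos_of_ne_zero hG)
        obtain ⟨w⟩ := nonempty_of_totalWeight_pos h0
        exact hadj (Sum.inl v) (Sum.inr w) (by simp [joinList, join])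
      obtain ⟨H, hH, hH', hHw⟩ := ih (by
        ext v w
        simpa [joinList, join] using hadj (Sum.inr v) (Sum.inr w)) h0
      exact ⟨H, List.mem_cons_of_mem _ hH, hH', by omega⟩

end WGraph

/-! ### Triangular systems and infinite linear combinations -/

/-- A square system of linear equations in possibly infinitely many unknowns, triangular with
respect to a rank function, has exactly one solution. -/
theorem existsUnique_of_triangular {K P : Type*} [Field K] (a : P → P → K) (r : P → ℕ)
    (hfin : ∀ q, {p | a p q ≠ 0}.Finite) (hdiag : ∀ q, a q q ≠ 0)
    (htri : ∀ p q, a p q ≠ 0 → p = q ∨ r p < r q) (F : P → K) :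
    ∃! c : P → K, ∀ q, F q = ∑ᶠ p, c p * a p q := by
  classical
  have hsplit : ∀ (c : P → K) q, ∑ᶠ p, c p * a p q =
      c q * a q q + ∑ p ∈ (hfin q).toFinset.erase q, c p * a p q := by
    intro c q
    rw [finsum_eq_sum_of_support_subset (s := (hfin q).toFinset),
      Finset.add_sum_erase _ (fun p => c p * a p q)]
    · simpa using hdiag q
    · intro p hp
      simp only [Set.Finite.coe_toFinset, Set.mem_ofPred_eq]
      exact right_ne_zero_of_mul hp
  have hlt : ∀ q, ∀ p ∈ (hfin q).toFinset.erase q, r p < r q := by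
    intro q p hp
    rw [Finset.mem_erase, Set.Finite.mem_toFinset] at hp
    exact (htri p q hp.2).resolve_left hp.1
  -- Equation `q` is solved for `c q`; its other unknowns have smaller rank.
  let c : P → K := (measure r).wf.fix fun q c =>
    (F q - ∑ p ∈ ((hfin q).toFinset.erase q).attach, c p (hlt q p p.2) * a p q) / a q q
  have hc : ∀ q, c q = (F q - ∑ p ∈ (hfin q).toFinset.erase q, c p * a p q) / a q q := by
    intro q
    rw [← Finset.sum_attach]
    exact (measure r).wf.fix_eq _ q
  refine ⟨c, fun q => ?_, fun c' hc' => ?_⟩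
  · rw [hsplit, hc q, div_mul_cancel₀ _ (hdiag q), sub_add_cancel]
  · funext q
    induction h : r q using Nat.strong_induction_on generalizing q with
    | _ n ih =>
      have h₁ := hc' q
      rw [hsplit] at h₁
      rw [hc q, eq_div_iff (hdiag q), h₁, eq_sub_iff_add_eq]
      congr 1
      refine Finset.sum_congr rfl fun p hp => ?_
      rw [ih (r p) (h ▸ hlt q p hp) p rfl]

theorem IsPseudobasis.of_comp_equiv {K ι ι' : Type*} [Semiring K]
    {W : Submodule K (MvPowerSeries ℕ K)} {b : ι → MvPowerSeries ℕ K} (e : ι' ≃ ι)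
    (h : IsPseudobasis W fun i => b (e i)) : IsPseudobasis W b := by
  have key : ∀ c f, IsLinComb b c f ↔ IsLinComb (fun i => b (e i)) (fun i => c (e i)) f := by
    intro c f
    refine forall_congr' fun d => and_congr ?_ ?_
    · exact ⟨fun h => h.preimage e.injective.injOn, fun h =>
        Set.Finite.of_preimage (f := e) h e.surjective⟩
    · rw [← finsum_comp_equiv e]
  refine ⟨fun i => by simpa using h.1 (e.symm i), fun f hf => ?_⟩
  obtain ⟨c, hc, hu⟩ := h.2 f hf
  refine ⟨fun i => c (e.symm i), (key _ _).2 (by simpa using hc), fun c' hc' => ?_⟩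
  funext i
  simpa using congrFun (hu _ ((key _ _).1 hc')) (e.symm i)

/-- A linear combination of a subfamily is a linear combination of the whole family. -/
theorem IsLinComb.extend {K ι ι' : Type*} [Semiring K] {b : ι → MvPowerSeries ℕ K}
    {s : ι' → ι} (hs : Function.Injective s) {c : ι' → K} {f : MvPowerSeries ℕ K}
    (h : IsLinComb (fun i => b (s i)) c f) : IsLinComb b (Function.extend s c 0) f := by
  intro d
  obtain ⟨h₁, h₂⟩ := h d
  have h₃ : ∀ i, Function.extend s c 0 i * MvPowerSeries.coeff d (b i) =
      Function.extend s (fun j => c j * MvPowerSeries.coeff d (b (s j))) 0 i := by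
    intro i
    by_cases hi : ∃ j, s j = i
    · obtain ⟨j, rfl⟩ := hi
      simp [hs.extend_apply]
    · simp [Function.extend_apply' _ _ _ hi]
  simp only [h₃]
  have h₄ : (Function.support (Function.extend s
      (fun j => c j * MvPowerSeries.coeff d (b (s j))) 0)) ⊆
      s '' {j | c j * MvPowerSeries.coeff d (b (s j)) ≠ 0} := by
    intro i hi
    by_cases hj : ∃ j, s j = i
    · obtain ⟨j, rfl⟩ := hj
      rw [Function.mem_support, hs.extend_apply] at hi
      exact ⟨j, hi, rfl⟩
    · simp [Function.extend_apply' _ _ _ hj] at hi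
  refine ⟨(h₁.image s).subset h₄, ?_⟩
  have h₅ := finsum_mem_image
    (f := Function.extend s (fun j => c j * MvPowerSeries.coeff d (b (s j))) 0)
    (s := Set.univ) hs.injOn
  simp only [finsum_mem_univ, hs.extend_apply] at h₅
  rw [h₂, ← h₅, finsum_mem_def,
    Set.indicator_eq_self.2 (h₄.trans (Set.image_mono (Set.subset_univ _)))]

theorem isLinComb_single {K ι : Type*} [Semiring K] [DecidableEq ι] (b : ι → MvPowerSeries ℕ K)
    (i : ι) : IsLinComb b (Pi.single i 1) (b i) := by
  intro d
  have h : ∀ j, j ≠ i → (Pi.single i 1 : ι → K) j * MvPowerSeries.coeff d (b j) = 0 := by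
    intro j hj
    simp [hj]
  refine ⟨(Set.finite_singleton i).subset fun j hj => by_contra fun hji => hj (h j hji), ?_⟩
  rw [finsum_eq_single _ i h]
  simp

theorem finite_multiset_of_le {N M : ℕ} :
    {p : Multiset ℕ+ | p.card ≤ M ∧ ∀ i ∈ p, (i : ℕ) ≤ N}.Finite := by
  -- No part occurs more than `M` times, so `p` lies below `M` copies of `1, …, N`. For `N = 0` the
  -- interval is `{1}`, which is harmless.
  refine (Set.finite_Iic (M • ((Finset.Icc 1 N.toPNat').val))).subset ?_
  rintro p ⟨h₁, h₂⟩
  refine Multiset.le_iff_count.2 fun i => ?_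
  by_cases hi : i ∈ p
  · have hN := h₂ i hi
    have : i ∈ Finset.Icc 1 N.toPNat' := by
      rw [Finset.mem_Icc, ← PNat.coe_le_coe, ← PNat.coe_le_coe, Nat.toPNat'_coe]
      have := i.pos
      split_ifs <;> simp <;> omega
    rw [Multiset.count_nsmul, Multiset.count_eq_one_of_mem (Finset.nodup _) this]
    have := Multiset.count_le_card i p
    omega
  · simp [Multiset.count_eq_zero_of_notMem hi]

/-! ### Cliques give a pseudobasis -/

namespace WGraph

theorem map_totalWeight_coJoin {G : ℕ+ → WGraph.{u}} (hw : ∀ n, (G n).totalWeight = n)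
    (p : Multiset ℕ+) :
    ((((p.sort (· ≥ ·)).map fun i => (G i).compl).map totalWeight : List ℕ) : Multiset ℕ) =
      p.map (fun i : ℕ+ => (i : ℕ)) := by
  rw [List.map_map, ← Multiset.map_coe, Multiset.sort_eq]
  exact Multiset.map_congr rfl fun i _ => hw i

/-- If `G n` is a clique of total weight `n` for all `n`, then the Kromatic symmetric functions of
the joins of complements form a pseudobasis. -/
theorem isPseudobasis_of_isClique (K : Type*) [Field K] [CharZero K] {G : ℕ+ → WGraph.{u}}
    (hG : ∀ n, (G n).IsClique) (hw : ∀ n, (G n).totalWeight = n) :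
    IsPseudobasis (symmetricSeries K) (fun p : Multiset ℕ+ => (coJoin G p).ksf K) := by
  have hpos : ∀ p : Multiset ℕ+, ∀ H ∈ (p.sort (· ≥ ·)).map fun i => (G i).compl,
      0 < H.totalWeight := by
    intro p H hH
    obtain ⟨i, -, rfl⟩ := List.mem_map.1 hH
    rw [totalWeight_compl, hw]
    exact i.pos
  have hex : ∀ p : Multiset ℕ+, ∃ d : ℕ →₀ ℕ, d.values = p.map (fun i : ℕ+ => (i : ℕ)) ∧
      MvPowerSeries.coeff d ((coJoin G p).ksf K) ≠ 0 := by
    intro p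
    obtain ⟨κ, h₁, h₂⟩ := exists_joinList_coloring _ (hpos p) (by
      intro H hH
      obtain ⟨i, -, rfl⟩ := List.mem_map.1 hH
      exact (hG i).compl_eq_bot)
    refine ⟨_, ?_, (coeff_ksf_ne_zero_iff _ _).2 ⟨κ, h₁, rfl⟩⟩
    rw [← map_totalWeight_coJoin hw p, ← h₂]
    rfl
  -- `D q` is the representative monomial of type `q`.
  choose D hD hD' using hex
  have hcard : ∀ p d, MvPowerSeries.coeff d ((coJoin G p).ksf K) ≠ 0 →
      p.card ≤ d.support.card ∧
      (d.support.card = p.card → d.values = p.map (fun i : ℕ+ => (i : ℕ))) ∧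
      ∀ i ∈ p, (i : ℕ) ≤ d.degree := by
    intro p d h
    obtain ⟨κ, hκ, rfl⟩ := (coeff_ksf_ne_zero_iff _ _).1 h
    have h₁ := joinList_coloring_support _ (hpos p) κ hκ
    rw [map_totalWeight_coJoin hw p, List.length_map, Multiset.length_sort] at h₁
    refine ⟨h₁.1, h₁.2, fun i hi => ?_⟩
    refine le_trans ?_ (totalWeight_le_degree hκ)
    rw [coJoin, totalWeight_joinList, ← Multiset.sum_coe, map_totalWeight_coJoin hw]
    exact Multiset.le_sum_of_mem (Multiset.mem_map_of_mem _ hi)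
  have hfin : ∀ d, {p | MvPowerSeries.coeff d ((coJoin G p).ksf K) ≠ 0}.Finite := fun d =>
    finite_multiset_of_le.subset fun p hp => ⟨(hcard p d hp).1, (hcard p d hp).2.2⟩
  refine ⟨fun p => ksf_mem_symmetricSeries K _, fun f hf => ?_⟩
  -- By symmetry the equations at the monomials `D q` imply all others; finiteness holds for every
  -- `c` by `hfin`.
  have hlin : ∀ c, IsLinComb (fun p : Multiset ℕ+ => (coJoin G p).ksf K) c f ↔
      ∀ q, MvPowerSeries.coeff (D q) f =
        ∑ᶠ p, c p * MvPowerSeries.coeff (D q) ((coJoin G p).ksf K) := by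
    refine fun c => ⟨fun h q => (h (D q)).2, fun h d => ⟨(hfin d).subset fun p hp =>
      right_ne_zero_of_mul hp, ?_⟩⟩
    obtain ⟨q, hq⟩ := d.exists_pnat_values
    have hq' : d.values = (D q).values := by rw [hD, hq]
    rw [coeff_eq_of_values_eq hf hq', h q]
    refine finsum_congr fun p => ?_
    rw [coeff_eq_of_values_eq (ksf_mem_symmetricSeries K _) hq']
  simp only [hlin]
  refine existsUnique_of_triangular
    (fun p q => MvPowerSeries.coeff (D q) ((coJoin G p).ksf K)) Multiset.card
    (fun q => hfin (D q)) hD' (fun p q h => ?_) _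
  obtain ⟨h₁, h₂, -⟩ := hcard p _ h
  have h₃ : (D q).support.card = q.card := by rw [← Finsupp.card_values, hD, Multiset.card_map]
  rcases (h₃ ▸ h₁).lt_or_eq with hlt | heq
  · exact Or.inr hlt
  · refine Or.inl (Multiset.map_injective PNat.coe_injective ?_)
    exact (h₂ (h₃.trans heq.symm)).symm.trans (hD q)

/-! ### A pseudobasis forces cliques of every weight -/

/-- The graph with one vertex, of weight `k`. -/
def vertex (k : ℕ+) : WGraph.{u} where
  V := PUnit.{u + 1}
  graph := ⊥
  weight := fun _ => k

/-- The Kromatic symmetric function of `G` contains a power `x₀ ^ k` only if `G` has no edges and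
total weight `k`. -/
theorem coeff_single_ksf_ne_zero_iff {K : Type*} [Semiring K] [CharZero K] (G : WGraph.{u})
    {k : ℕ} (hk : k ≠ 0) :
    MvPowerSeries.coeff (Finsupp.single 0 k) (G.ksf K) ≠ 0 ↔
      G.graph = ⊥ ∧ G.totalWeight = k := by
  rw [coeff_ksf_ne_zero_iff]
  constructor
  · rintro ⟨κ, hκ, h⟩
    have hκ0 : κ = fun _ => {0} := by
      funext v
      have h0 : (Finsupp.single 0 k : ℕ →₀ ℕ).support = {0} := by simp [hk]
      refine (hκ.1 v).subset_singleton_iff.1 fun j hj => ?_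
      rw [← h0, ← h, support_colorExponent]
      exact ⟨v, hj⟩
    subst hκ0
    refine ⟨?_, ?_⟩
    -- Adjacent vertices would need disjoint sets, but all sets are `{0}`.
    · ext v w
      simpa using hκ.2 v w
    · rw [colorExponent_const] at h
      exact Finsupp.single_injective 0 h
  · rintro ⟨h, rfl⟩
    exact ⟨fun _ => {0}, ⟨by simp, by simp [h]⟩, colorExponent_const _ _⟩

theorem exists_isClique_of_isPseudobasis {K : Type*} [Field K] [CharZero K]
    {G : ℕ+ → WGraph.{u}}
    (h : IsPseudobasis (symmetricSeries K) (fun p : Multiset ℕ+ => (coJoin G p).ksf K))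
    (k : ℕ+) : ∃ n, (G n).IsClique ∧ (G n).totalWeight = k := by
  obtain ⟨c, hc, -⟩ := h.2 _ (ksf_mem_symmetricSeries K (vertex.{u} k))
  have h₁ : MvPowerSeries.coeff (Finsupp.single 0 (k : ℕ)) ((vertex.{u} k).ksf K) ≠ 0 :=
    (coeff_single_ksf_ne_zero_iff _ k.ne_zero).2 ⟨rfl, by
      change ∑ _ : PUnit, (k : ℕ) = k
      simp⟩
  rw [(hc _).2] at h₁
  obtain ⟨p, hp⟩ := not_forall.1 (mt finsum_eq_zero_of_forall_eq_zero h₁)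
  obtain ⟨h₂, h₃⟩ := (coeff_single_ksf_ne_zero_iff _ k.ne_zero).1 (right_ne_zero_of_mul hp)
  obtain ⟨H, hH, h₄, h₅⟩ := exists_mem_of_joinList_eq_bot _ h₂ (h₃ ▸ k.pos)
  obtain ⟨n, -, rfl⟩ := List.mem_map.1 hH
  exact ⟨n, isClique_of_compl_eq_bot h₄, h₅.trans h₃⟩

end WGraph

/-! ### The equivalence -/

theorem mainTheorem11 {K : Type*} [Field K] [CharZero K] (G : ℕ+ → WGraph.{u}) :
    IsPseudobasis (symmetricSeries K) (fun p : Multiset ℕ+ => (WGraph.coJoin G p).ksf K) ↔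
      ∃ σ : Equiv.Perm ℕ+, ∀ n : ℕ+,
        (G (σ n)).IsClique ∧ (G (σ n)).totalWeight = n := by
  classical
  constructor
  · intro h
    choose s hs hw using WGraph.exists_isClique_of_isPseudobasis h
    have hinj : Function.Injective s := fun m n hmn => by
      rw [← PNat.coe_inj, ← hw m, ← hw n, hmn]
    have hsurj : Function.Surjective s := by
      intro m
      by_contra hm
      have hmem := WGraph.ksf_mem_symmetricSeries K (WGraph.coJoin G {m})
      obtain ⟨c, hc, -⟩ := (WGraph.isPseudobasis_of_isClique K hs hw).2 _ hmem
      simp only [WGraph.ksf_coJoin_comp] at hc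
      have hc' := IsLinComb.extend (b := fun p : Multiset ℕ+ => (WGraph.coJoin G p).ksf K)
        (Multiset.map_injective hinj) hc
      -- At `{m}` the extended expansion has coefficient `0`, since `m` is not in the range of `s`,
      -- while the trivial one has `1`.
      have heq := congrFun ((h.2 _ hmem).unique hc' (isLinComb_single _ _)) {m}
      rw [Pi.single_eq_same, Function.extend_apply'] at heq
      · exact zero_ne_one heq
      · rintro ⟨p, hp⟩
        obtain ⟨n, -, hn⟩ := Multiset.mem_map.1 (hp ▸ Multiset.mem_singleton_self m)
        exact hm ⟨n, hn⟩
    exact ⟨Equiv.ofBijective s ⟨hinj, hsurj⟩, fun n => ⟨hs n, hw n⟩⟩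
  · rintro ⟨σ, hσ⟩
    have h := WGraph.isPseudobasis_of_isClique K (fun n => (hσ n).1) (fun n => (hσ n).2)
    simp only [WGraph.ksf_coJoin_comp] at h
    exact IsPseudobasis.of_comp_equiv (b := fun p : Multiset ℕ+ => (WGraph.coJoin G p).ksf K)
      ⟨Multiset.map σ, Multiset.map σ.symm, fun p => by simp, fun p => by simp⟩ h
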